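/- Let $F$ be a finite field with $q$ elements, $q$ odd. For $n\ge 1$ put $R_n=F[X]/\langle X^n-1\rangle$. For a positive integer $m$ coprime to $q$, a *quasi-cyclic code over $F$ of index $1\frac12$ and co-index $2m$* is an $F$-linear subspace $C$ of $R_{2m}\times R_m$ such that $(Xc,Xc')\in C$ for all $(c,c')\in C$ (equivalently, an $F[X]$-submodule). Identifying $\big(\sum_{j=0}^{2m-1}a_jX^j,\ \sum_{j=0}^{m-1}a'_jX^j\big)$ with the word $(a_0,\dots,a_{2m-1},a'_0,\dots,a'_{m-1})\in F^{3m}$, such a $C$ is a linear code of length $3m$. For a linear code $C\subseteq F^n$ write $R(C)=\frac{\dim C}{n}$ for its rate and $\Delta(C)=\frac{d(C)}{n}$ for its relative minimum distance, where $d(C)$ is the minimum Hamming weight of the nonzero codewords of $C$ (and $d(C)=0$ if $C=0$). Let $h_q(x)=x\log_q(q-1)-x\log_q x-(1-x)\log_q(1-x)$, with $0\log_q 0=0$, be the $q$-ary entropy, and let $h_q^{-1}:[0,1]\to[0,1-q^{-1}]$ be the inverse of the bijection $h_q:[0,1-q^{-1}]\to[0,1]$. Then for every real $\delta$ with $0<\delta<\frac23h_q^{-1}(\frac12)$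 there are positive integers $m_1,m_2,\dots$ coprime to $q$ and quasi-cyclic codes $C_i$ over $F$ of index $1\frac12$ and co-index $2m_i$ ($i=1,2,\dots$) such that $2m_i\to\infty$ and (i) $\lim_{i\to\infty}R(C_i)=\frac13$; (ii) $\Delta(C_i)>\delta$ for all $i=1,2,\dots$. Consequently the class of quasi-cyclic codes over $F$ of index $1\frac12$ is asymptotically good: it contains a sequence of codes whose lengths go to infinity and whose rates and relative minimum distances are all bounded from below by positive constants. -/

import Mathlib

open Polynomial Filter Topology

noncomputable section

namespace QuasiCyclic

/-! ### Linear codes of length `n`: subspaces of `F^n` -/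

/-- The rate `dim C / n` of a linear code of length `n`. -/
def rate {F : Type*} [Field F] {n : ℕ} (C : Submodule F (Fin n → F)) : ℝ :=
  (Module.finrank F C : ℝ) / n

/-- The minimum Hamming weight of the nonzero codewords. (The zero code, which has no nonzero
codeword, gets the value `0`, so it never satisfies a positive lower bound.) -/
def minDist {F : Type*} [Field F] [DecidableEq F] {n : ℕ} (C : Submodule F (Fin n → F)) : ℕ :=
  sInf {w : ℕ | ∃ c ∈ C, c ≠ 0 ∧ hammingNorm c = w}

/-- The relative minimum distance `d(C) / n`. -/
def relMinDist {F : Type*} [Field F] [DecidableEq F] {n : ℕ}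
    (C : Submodule F (Fin n → F)) : ℝ :=
  (minDist C : ℝ) / n

/-- An asymptotically good sequence of codes: the lengths go to infinity, and the rates and the
relative minimum distances are bounded from below by positive constants. -/
def IsAsymptoticallyGoodSeq {F : Type*} [Field F] [DecidableEq F] (n : ℕ → ℕ)
    (C : ∀ i, Submodule F (Fin (n i) → F)) : Prop :=
  Tendsto n atTop atTop ∧
    (∃ r : ℝ, 0 < r ∧ ∀ i, r ≤ rate (C i)) ∧
    (∃ r : ℝ, 0 < r ∧ ∀ i, r ≤ relMinDist (C i))

/-- A class of linear codes (of varying lengths) is asymptotically good if it contains an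
asymptotically good sequence. -/
def IsAsymptoticallyGoodClass {F : Type*} [Field F] [DecidableEq F]
    (K : Set (Σ n : ℕ, Submodule F (Fin n → F))) : Prop :=
  ∃ (n : ℕ → ℕ) (C : ∀ i, Submodule F (Fin (n i) → F)),
    (∀ i, (⟨n i, C i⟩ : Σ n : ℕ, Submodule F (Fin n → F)) ∈ K) ∧ IsAsymptoticallyGoodSeq n C

/-! ### Quasi-cyclic codes of index `1½` -/

/-- The ring `R_n = F[X] / ⟨X^n - 1⟩`. -/
abbrev R (F : Type*) [Field F] (n : ℕ) : Type _ := AdjoinRoot (X ^ n - 1 : F[X])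

/-- The element `a_0 + a_1 X + ⋯ + a_{n-1} X^{n-1}` of `R_n` given by the word
`(a_0, …, a_{n-1})`. -/
def ofWord (F : Type*) [Field F] (n : ℕ) : (Fin n → F) →ₗ[F] R F n :=
  Fintype.linearCombination F fun j : Fin n => AdjoinRoot.root (X ^ n - 1 : F[X]) ^ (j : ℕ)

/-- Every element of `R_n` is given by exactly one word. -/
theorem ofWord_bijective (F : Type*) [Field F] {n : ℕ} (hn : 0 < n) :
    Function.Bijective (ofWord F n) := by
  have hm : (X ^ n - 1 : F[X]).Monic := monic_X_pow_sub_C (1 : F) hn.ne'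
  have hd : (X ^ n - 1 : F[X]).natDegree = n := natDegree_X_pow_sub_C (r := (1 : F))
  have hdim : Module.finrank F (R F n) = n := by
    rw [(AdjoinRoot.powerBasis' hm).finrank, AdjoinRoot.powerBasis'_dim, hd]
  have hfin : Module.Finite F (R F n) := (AdjoinRoot.powerBasis' hm).finite
  have hsurj : Function.Surjective (ofWord F n) := by
    intro a
    obtain ⟨p, rfl⟩ := AdjoinRoot.mk_surjective a
    refine ⟨fun j => (p %ₘ (X ^ n - 1)).coeff j, ?_⟩
    have hlt : (p %ₘ (X ^ n - 1)).natDegree < n := by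
      have h1 : (X ^ n - 1 : F[X]) ≠ 1 := by
        intro h
        rw [h, natDegree_one] at hd
        omega
      simpa only [hd] using natDegree_modByMonic_lt p hm h1
    have h2 : AdjoinRoot.mk (X ^ n - 1 : F[X]) p
        = AdjoinRoot.mk (X ^ n - 1 : F[X]) (p %ₘ (X ^ n - 1)) := by
      rw [AdjoinRoot.mk_eq_mk]
      exact ⟨p /ₘ (X ^ n - 1), by
        have := modByMonic_add_div p (X ^ n - 1 : F[X])
        linear_combination -this⟩
    rw [h2]
    conv_rhs => rw [(p %ₘ (X ^ n - 1)).as_sum_range' n hlt]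
    simp only [ofWord, Fintype.linearCombination_apply, map_sum, ← C_mul_X_pow_eq_monomial,
      map_mul, map_pow, AdjoinRoot.mk_X, AdjoinRoot.mk_C]
    rw [Finset.sum_range]
    refine Finset.sum_congr rfl fun j _ => ?_
    rw [Algebra.smul_def, AdjoinRoot.algebraMap_eq]
  refine ⟨?_, hsurj⟩
  exact (LinearMap.injective_iff_surjective_of_finrank_eq_finrank (by simp [hdim])).2 hsurj

/-- The element `(a(X), a'(X))` of `R_{2m} × R_m` given by the word
`(a_0, …, a_{2m-1}, a'_0, …, a'_{m-1})` of length `2m + m = 3m`. -/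
def ofWords (F : Type*) [Field F] (m : ℕ) :
    (Fin (2 * m + m) → F) →ₗ[F] R F (2 * m) × R F m :=
  LinearMap.prod
    (ofWord F (2 * m) ∘ₗ LinearMap.funLeft F F (Fin.castAdd m))
    (ofWord F m ∘ₗ LinearMap.funLeft F F (Fin.natAdd (2 * m)))

/-- A linear subspace of `R_{2m} × R_m` is a quasi-cyclic code of index `1½` and co-index `2m` if
it is invariant under multiplication by `X`. -/
def IsQuasiCyclic {F : Type*} [Field F] {m : ℕ} (C : Submodule F (R F (2 * m) × R F m)) : Prop :=
  ∀ c ∈ C, (AdjoinRoot.root (X ^ (2 * m) - 1 : F[X]) * c.1,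
    AdjoinRoot.root (X ^ m - 1 : F[X]) * c.2) ∈ C

/-- Equivalently, it is an `F[X]`-submodule: it is invariant under multiplication by every
polynomial. -/
theorem isQuasiCyclic_iff {F : Type*} [Field F] {m : ℕ}
    (C : Submodule F (R F (2 * m) × R F m)) :
    IsQuasiCyclic C ↔ ∀ f : F[X], ∀ c ∈ C,
      (AdjoinRoot.mk (X ^ (2 * m) - 1 : F[X]) f * c.1,
        AdjoinRoot.mk (X ^ m - 1 : F[X]) f * c.2) ∈ C := by
  refine ⟨fun h f => ?_, fun h c hc => by simpa only [AdjoinRoot.mk_X] using h X c hc⟩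
  induction f using Polynomial.induction_on' with
  | add p r hp hr =>
    intro c hc
    simpa only [map_add, add_mul, Prod.mk_add_mk] using C.add_mem (hp c hc) (hr c hc)
  | monomial k a =>
    induction k with
    | zero =>
      intro c hc
      have := C.smul_mem a hc
      simp only [monomial_zero_left, AdjoinRoot.mk_C, ← AdjoinRoot.algebraMap_eq,
        ← Algebra.smul_def]
      exact this
    | succ k ih =>
      intro c hc
      have := ih _ (h c hc)
      rw [← monomial_mul_X]
      simpa only [map_mul, AdjoinRoot.mk_X, mul_assoc] using this

/-- A subspace of `R_{2m} × R_m` regarded as a linear code of length `3m`, through the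
identification of `R_{2m} × R_m` with `F^{2m} × F^m` by coefficients. -/
def toCode {F : Type*} [Field F] {m : ℕ} (C : Submodule F (R F (2 * m) × R F m)) :
    Submodule F (Fin (2 * m + m) → F) :=
  C.comap (ofWords F m)

/-- The class of all quasi-cyclic codes over `F` of index `1½` (and of co-index `2m` for
positive integers `m` coprime to the number of elements of `F`). -/
def quasiCyclicCodes (F : Type*) [Field F] [Fintype F] :
    Set (Σ n : ℕ, Submodule F (Fin n → F)) :=
  {D | ∃ m : ℕ, 0 < m ∧ m.Coprime (Fintype.card F) ∧
    ∃ C : Submodule F (R F (2 * m) × R F m), IsQuasiCyclic C ∧ D = ⟨2 * m + m, toCode C⟩}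

/-! ### The `q`-ary entropy function and its inverse -/

/-- The `q`-ary entropy `h_q(x) = x log_q (q-1) - x log_q x - (1-x) log_q (1-x)`
(here `0 log_q 0 = 0`). -/
def entropy (q : ℕ) (x : ℝ) : ℝ :=
  x * Real.logb q (q - 1) - x * Real.logb q x - (1 - x) * Real.logb q (1 - x)

theorem entropy_eq (q : ℕ) (x : ℝ) : entropy q x = Real.qaryEntropy q x / Real.log q := by
  simp only [entropy, Real.qaryEntropy, Real.binEntropy, Real.logb, Real.log_inv]
  push_cast
  ring

/-- The inverse `h_q⁻¹ : [0, 1] → [0, 1 - q⁻¹]` of the `q`-ary entropy, which is a bijection from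
`[0, 1 - q⁻¹]` onto `[0, 1]`. -/
def entropyInv (q : ℕ) (y : ℝ) : ℝ :=
  Function.invFunOn (entropy q) (Set.Icc 0 (1 - (q : ℝ)⁻¹)) y

theorem entropy_bijOn {q : ℕ} (hq : 2 ≤ q) :
    Set.BijOn (entropy q) (Set.Icc 0 (1 - (q : ℝ)⁻¹)) (Set.Icc 0 1) := by
  have hq' : (2 : ℝ) ≤ q := by exact_mod_cast hq
  have hlog : 0 < Real.log q := Real.log_pos (by linarith)
  have hle : (0 : ℝ) ≤ 1 - (q : ℝ)⁻¹ := by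
    have : (q : ℝ)⁻¹ ≤ 1 := inv_le_one_of_one_le₀ (by linarith)
    linarith
  have hmono : StrictMonoOn (entropy q) (Set.Icc 0 (1 - (q : ℝ)⁻¹)) := by
    intro a ha b hb hab
    rw [entropy_eq, entropy_eq]
    rw [← one_div] at ha hb
    exact div_lt_div_of_pos_right (Real.qaryEntropy_strictMonoOn hq ha hb hab) hlog
  have hcont : Continuous (entropy q) := by
    have : entropy q = fun x => Real.qaryEntropy q x / Real.log q := funext (entropy_eq q)
    rw [this]
    exact Real.qaryEntropy_continuous.div_const _
  have h0 : entropy q 0 = 0 := by simp [entropy]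
  have h1 : entropy q (1 - (q : ℝ)⁻¹) = 1 := by
    have hq1 : (q : ℝ) - 1 ≠ 0 := by linarith
    have hq0 : (q : ℝ) ≠ 0 := by linarith
    have e : 1 - (q : ℝ)⁻¹ = (q - 1) / q := by field_simp
    have e2 : 1 - ((q : ℝ) - 1) / q = (q : ℝ)⁻¹ := by field_simp; ring
    rw [entropy, e, e2, Real.logb, Real.logb, Real.logb, Real.log_div hq1 hq0, Real.log_inv]
    field_simp
    ring
  refine ⟨?_, hmono.injOn, ?_⟩
  · intro x hx
    refine ⟨?_, ?_⟩
    · rw [← h0]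
      exact hmono.monotoneOn ⟨le_rfl, hle⟩ hx hx.1
    · rw [← h1]
      exact hmono.monotoneOn hx ⟨hle, le_rfl⟩ hx.2
  · have := intermediate_value_Icc hle hcont.continuousOn
    rwa [h0, h1] at this

end QuasiCyclic

end

/-! The proof is a counting argument over multipliers. Let `m = 2^(s+j)`, `A = X^(2^s) - 1` and `G =
(X^m - 1)/A`. For a polynomial `B`, consider the code of all pairs `((X^m + 1) A p, A B p)`. A pair
vanishes exactly when `G ∣ p`, so whatever `B` is, the dimension is `m - 2^s` and the rate is `(1 -
2⁻ʲ)/3`. Multiplication by `X^m + 1` repeats the word of `f = A p`, so a codeword weighs at least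
`wt(f) + wt(f B)`. It suffices to find `B` making this sum exceed `2mτ`, with `τ = 3δ/2`, for all
nonzero multiples `f` of `A` in `R_m`.

If no `B` works, each `b` in `R_m` has a bad `f`. Sort the `b` by the ideal `J = (f)`, of dimension
`k`. Averaging over translates of an information set shows that `J × J` contains at most `m q^(2kh)`
light pairs, where `h = h_q(τ) < 1/2` (`card_light_pairs_le`). Each pair has the form `(f, f b)` for
at most `|R_m|/q^k` values of `b` (`card_solutions_mul_card_span_le`). So `J` accounts for at most a
fraction `m q^(-(1-2h)k)` of all `b`.

Since `m` is a power of two, irreducible factors of `G` have degree at least `2^s/q²`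
(`two_pow_le_natDegree_mul`). Hence `k ≥ 2^s/q²`, and at most `2^(q² 2^j)` ideals occur, a number
independent of `s`. For fixed `j` and large `s` the fractions sum to less than 1, a contradiction
(`exists_multiplier`). Letting `j` grow brings the rate to `1/3`. -/

namespace QuasiCyclic

/-! ### Information sets and light pairs in translation invariant codes -/

/-- Every linear code has an information set: a set of `dim J` coordinates that determine
each codeword. -/
theorem exists_information_set {F ι : Type*} [Field F] [Fintype ι] (J : Submodule F (ι → F)) :
    ∃ S : Finset ι, S.card = Module.finrank F J ∧ ∀ u ∈ J, (∀ i ∈ S, u i = 0) → u = 0 := by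
  classical
  let φ : ι → Module.Dual F J := fun i => (LinearMap.proj i).comp J.subtype
  -- The set consists of coordinates whose functionals on `J` form a basis of the span of all
  -- coordinate functionals.
  obtain ⟨κ, a, ha, hspan, hli⟩ := exists_linearIndependent' F φ
  have : Finite κ := Finite.of_injective a ha
  have := Fintype.ofFinite κ
  let S : Finset ι := Finset.univ.image a
  have hS : ∀ u ∈ J, (∀ i ∈ S, u i = 0) → u = 0 := by
    intro u hu h
    have key : ∀ ψ ∈ Submodule.span F (Set.range φ), ψ ⟨u, hu⟩ = 0 := by
      rw [← hspan]
      intro ψ hψ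
      induction hψ using Submodule.span_induction with
      | mem x hx =>
        obtain ⟨k, rfl⟩ := hx
        exact h (a k) (Finset.mem_image_of_mem _ (Finset.mem_univ _))
      | zero => rfl
      | add x y _ _ hx hy => simp [hx, hy]
      | smul c x _ hx => simp [hx]
    funext i
    exact key (φ i) (Submodule.subset_span ⟨i, rfl⟩)
  refine ⟨S, le_antisymm ?_ ?_, hS⟩
  · rw [Finset.card_image_of_injective _ ha, Finset.card_univ,
      ← Subspace.dual_finrank_eq (K := F) (V := J)]
    exact hli.fintype_card_le_finrank
  · let ρ : J →ₗ[F] (S → F) := (LinearMap.funLeft F F (Subtype.val : S → ι)).comp J.subtype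
    have hρ : Function.Injective ρ := by
      rw [← LinearMap.ker_eq_bot, LinearMap.ker_eq_bot']
      intro u hu
      exact Subtype.ext (hS u u.2 fun i hi => congrFun hu ⟨i, hi⟩)
    simpa using LinearMap.finrank_le_finrank_of_injective hρ

/-- The weight enumerator of the full space. -/
theorem sum_pow_hammingNorm {F ι : Type*} [Field F] [Fintype F] [DecidableEq F] [Fintype ι]
    [DecidableEq ι] (z : ℝ) :
    ∑ x : ι → F, z ^ hammingNorm x
      = (1 + ((Fintype.card F : ℝ) - 1) * z) ^ Fintype.card ι := by
  have h1 : ∀ x : ι → F, z ^ hammingNorm x = ∏ i, if x i = 0 then 1 else z := by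
    intro x
    rw [hammingNorm, ← Finset.prod_const, Finset.prod_filter]
    exact Finset.prod_congr rfl fun i _ => by by_cases h : x i = 0 <;> simp [h]
  have h2 : ∑ a : F, (if a = 0 then (1 : ℝ) else z) = 1 + ((Fintype.card F : ℝ) - 1) * z := by
    rw [← Finset.add_sum_erase _ _ (Finset.mem_univ (0 : F)), if_pos rfl]
    congr 1
    rw [Finset.sum_congr rfl (g := fun _ => z) fun a ha => if_neg (Finset.ne_of_mem_erase ha),
      Finset.sum_const, Finset.card_erase_of_mem (Finset.mem_univ _), Finset.card_univ,
      nsmul_eq_mul, Nat.cast_sub Fintype.card_pos, Nat.cast_one]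
  simp_rw [h1]
  rw [← h2, ← Finset.card_univ (α := ι), ← Finset.prod_const, Finset.prod_univ_sum,
    Fintype.piFinset_univ]

/-- The optimal exponential bound for the weight enumerator is the entropy. -/
theorem weight_enumerator_base_eq {q : ℕ} (hq : 2 ≤ q) {τ : ℝ} (h0 : 0 < τ) (h1 : τ < 1) :
    (1 + ((q : ℝ) - 1) * (τ / (((q : ℝ) - 1) * (1 - τ))))
      = (q : ℝ) ^ entropy q τ * (τ / (((q : ℝ) - 1) * (1 - τ))) ^ τ := by
  have hq2 : (2 : ℝ) ≤ q := by exact_mod_cast hq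
  have hq1 : (0 : ℝ) < q - 1 := by linarith
  have ht : 0 < 1 - τ := by linarith
  have hl : Real.log q ≠ 0 := (Real.log_pos (by linarith)).ne'
  have e : 1 + ((q : ℝ) - 1) * (τ / (((q : ℝ) - 1) * (1 - τ))) = (1 - τ)⁻¹ := by
    field_simp
    ring
  rw [e]
  apply Real.log_injOn_pos (Set.mem_Ioi.2 (by positivity)) (Set.mem_Ioi.2 (by positivity))
  rw [Real.log_mul (by positivity) (by positivity), Real.log_rpow (by linarith),
    Real.log_rpow (by positivity), Real.log_inv, Real.log_div h0.ne' (by positivity),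
    Real.log_mul hq1.ne' ht.ne', entropy, Real.logb, Real.logb, Real.logb]
  field_simp
  ring

/-- A translation invariant code `J` of dimension `k` contains few pairs of codewords of small
total weight. -/
theorem card_light_pairs_le {F ι : Type*} [Field F] [Fintype F] [DecidableEq F] [Fintype ι]
    [AddCommGroup ι] {J : Submodule F (ι → F)}
    (hJ : ∀ u ∈ J, ∀ t : ι, (fun i => u (i + t)) ∈ J) {τ : ℝ} (h0 : 0 < τ)
    (h1 : τ ≤ 1 - (Fintype.card F : ℝ)⁻¹) (T : Finset ((ι → F) × (ι → F)))
    (hT : ∀ p ∈ T, p.1 ∈ J ∧ p.2 ∈ J ∧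
      (hammingNorm p.1 + hammingNorm p.2 : ℝ) ≤ 2 * Fintype.card ι * τ) :
    (T.card : ℝ) ≤ Fintype.card ι *
      (Fintype.card F : ℝ) ^ (2 * Module.finrank F J * entropy (Fintype.card F) τ) := by
  classical
  set q := Fintype.card F with hqdef
  have hq : 2 ≤ q := Fintype.one_lt_card
  have hq2 : (2 : ℝ) ≤ q := by exact_mod_cast hq
  have hq1 : (0 : ℝ) < q - 1 := by linarith
  have hτ : τ < 1 := lt_of_le_of_lt h1 (by have : (0 : ℝ) < (q : ℝ)⁻¹ := by positivity
                                           linarith)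
  have ht : 0 < 1 - τ := by linarith
  -- This `z` minimizes `(1 + (q-1) z) z^(-τ)`; the hypothesis `τ ≤ 1 - 1/q` is what gives `z ≤ 1`.
  set z : ℝ := τ / (((q : ℝ) - 1) * (1 - τ)) with hz
  have hz0 : 0 < z := by positivity
  have hz1 : z ≤ 1 := by
    rw [hz, div_le_one (by positivity)]
    have : τ * q ≤ (1 - (q : ℝ)⁻¹) * q := mul_le_mul_of_nonneg_right h1 (by linarith)
    rw [sub_mul, inv_mul_cancel₀ (by linarith)] at this
    nlinarith
  obtain ⟨S, hScard, hS⟩ := exists_information_set J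
  set k := Module.finrank F J with hk
  -- Restriction to the translate `S + t`, which is again an information set because `J` is
  -- translation invariant.
  let r : ι → (ι → F) → (S → F) := fun t u i => u (i + t)
  have hrinj : ∀ t, ∀ u ∈ J, ∀ v ∈ J, r t u = r t v → u = v := by
    intro t u hu v hv huv
    have h := hS _ (hJ _ (J.sub_mem hu hv) t) fun i hi => by
      have := congrFun huv ⟨i, hi⟩
      simpa [r, sub_eq_zero] using this
    funext i
    have := congrFun h (i - t)
    simpa [sub_eq_zero] using this
  -- Each coordinate lies in exactly `k` of the translates `S + t`.
  have havg : ∀ u : ι → F, ∑ t, hammingNorm (r t u) = k * hammingNorm u := by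
    intro u
    simp only [hammingNorm, Finset.card_filter, r]
    rw [Finset.sum_comm]
    have : ∀ i : S, ∑ t, (if u (i + t) ≠ 0 then 1 else 0) = ∑ t, if u t ≠ 0 then 1 else 0 :=
      fun i => Equiv.sum_comp (Equiv.addLeft (i : ι)) fun t => if u t ≠ 0 then 1 else 0
    rw [Finset.sum_congr rfl fun i _ => this i]
    simp [hScard]
  let a : ι → (ι → F) × (ι → F) → ℕ := fun t p => hammingNorm (r t p.1) + hammingNorm (r t p.2)
  -- Some translate sees at most the average weight, hence at most `2kτ`. Summing over all `t`
  -- instead of choosing one costs the factor `card ι`.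
  have hlow : ∀ p ∈ T, z ^ (2 * k * τ : ℝ) ≤ ∑ t, z ^ a t p := by
    intro p hp
    obtain ⟨-, -, hw⟩ := hT p hp
    obtain ⟨t, -, ht⟩ : ∃ t ∈ (Finset.univ : Finset ι), (a t p : ℝ) ≤ 2 * k * τ := by
      apply Finset.exists_le_of_sum_le Finset.univ_nonempty
      have : ∑ t, a t p = k * hammingNorm p.1 + k * hammingNorm p.2 := by
        simp only [a, Finset.sum_add_distrib, havg]
      rw [← Nat.cast_sum, this, Finset.sum_const, Finset.card_univ, nsmul_eq_mul]
      push_cast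
      have := mul_le_mul_of_nonneg_left hw (Nat.cast_nonneg (α := ℝ) k)
      linarith
    calc z ^ (2 * k * τ : ℝ) ≤ z ^ (a t p : ℝ) := Real.rpow_le_rpow_of_exponent_ge hz0 hz1 ht
      _ = z ^ a t p := Real.rpow_natCast _ _
      _ ≤ _ := Finset.single_le_sum (f := fun t => z ^ a t p) (fun t _ => by positivity)
        (Finset.mem_univ t)
  have hup : ∀ t, ∑ p ∈ T, z ^ a t p ≤ ((1 + ((q : ℝ) - 1) * z) ^ k) ^ 2 := by
    intro t
    let φ : (ι → F) × (ι → F) → (S → F) × (S → F) := fun p => (r t p.1, r t p.2)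
    have hφ : Set.InjOn φ T := by
      intro p hp p' hp' h
      obtain ⟨hp1, hp2, -⟩ := hT p hp
      obtain ⟨hp1', hp2', -⟩ := hT p' hp'
      exact Prod.ext (hrinj t _ hp1 _ hp1' (congrArg Prod.fst h))
        (hrinj t _ hp2 _ hp2' (congrArg Prod.snd h))
    calc ∑ p ∈ T, z ^ a t p
        = ∑ y ∈ T.image φ, z ^ hammingNorm y.1 * z ^ hammingNorm y.2 := by
          rw [Finset.sum_image hφ]
          exact Finset.sum_congr rfl fun p _ => pow_add _ _ _
      _ ≤ ∑ y : (S → F) × (S → F), z ^ hammingNorm y.1 * z ^ hammingNorm y.2 :=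
          Finset.sum_le_sum_of_subset_of_nonneg (Finset.subset_univ _)
            fun _ _ _ => by positivity
      _ = _ := by
          rw [Fintype.sum_prod_type]
          simp_rw [← Finset.mul_sum, ← Finset.sum_mul]
          rw [sum_pow_hammingNorm, Fintype.card_coe, hScard, sq]
  have hmain : (T.card : ℝ) * z ^ (2 * k * τ : ℝ)
      ≤ Fintype.card ι * ((1 + ((q : ℝ) - 1) * z) ^ k) ^ 2 := by
    calc (T.card : ℝ) * z ^ (2 * k * τ : ℝ) = ∑ p ∈ T, z ^ (2 * k * τ : ℝ) := by simp
      _ ≤ ∑ p ∈ T, ∑ t, z ^ a t p := Finset.sum_le_sum hlow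
      _ = ∑ t, ∑ p ∈ T, z ^ a t p := Finset.sum_comm
      _ ≤ ∑ _t : ι, ((1 + ((q : ℝ) - 1) * z) ^ k) ^ 2 := Finset.sum_le_sum fun t _ => hup t
      _ = _ := by simp
  have hval : ((1 + ((q : ℝ) - 1) * z) ^ k) ^ 2
      = (q : ℝ) ^ (2 * k * entropy q τ) * z ^ (2 * k * τ : ℝ) := by
    rw [hz, weight_enumerator_base_eq hq h0 hτ, ← hz, ← pow_mul, mul_pow, ← Real.rpow_mul_natCast
      (by positivity), ← Real.rpow_mul_natCast hz0.le]
    push_cast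
    ring_nf
  rw [hval, ← mul_assoc] at hmain
  exact le_of_mul_le_mul_right hmain (by positivity)

/-! ### Irreducible factors of `(X^(2^(s+j)) - 1) / (X^(2^s) - 1)` -/

/-- Lifting the exponent, after doubling `d` to make it even, gives `v₂(q^(2d) - 1) = v₂(q+1) +
v₂(q-1) + v₂(d)`. Each 2-part is at most the number itself. -/
theorem two_pow_le_of_dvd_pow_sub_one {q s d : ℕ} (hq : Odd q) (hq1 : 1 < q) (hd : 0 < d)
    (h : 2 ^ s ∣ q ^ d - 1) : 2 ^ s ≤ d * q ^ 2 := by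
  have hdvd : 2 ^ s ∣ q ^ (2 * d) - 1 := by
    refine h.trans ?_
    rw [mul_comm, pow_mul]
    simpa using Nat.sub_dvd_pow_sub_pow (q ^ d) 1 2
  have hne : q ^ (2 * d) - 1 ≠ 0 := by
    have : 1 < q ^ (2 * d) := Nat.one_lt_pow (by omega) hq1
    omega
  have h2 : ¬ 2 ∣ q := by rwa [← even_iff_two_dvd, Nat.not_even_iff_odd]
  have hs : s ≤ padicValNat 2 (q ^ (2 * d) - 1) := (padicValNat_dvd_iff_le hne).1 hdvd
  have hlte := padicValNat.pow_two_sub_one hq1 h2 (n := 2 * d) (by omega) (even_two_mul d)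
  rw [padicValNat.mul two_ne_zero hd.ne', padicValNat.self one_lt_two] at hlte
  have hs' : s ≤ padicValNat 2 (q + 1) + padicValNat 2 (q - 1) + padicValNat 2 d := by omega
  have hle : ∀ {a : ℕ}, 0 < a → 2 ^ padicValNat 2 a ≤ a := fun ha =>
    Nat.le_of_dvd ha pow_padicValNat_dvd
  calc 2 ^ s ≤ 2 ^ (padicValNat 2 (q + 1) + padicValNat 2 (q - 1) + padicValNat 2 d) :=
        Nat.pow_le_pow_right two_pos hs'
    _ = 2 ^ padicValNat 2 (q + 1) * 2 ^ padicValNat 2 (q - 1) * 2 ^ padicValNat 2 d := by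
        rw [pow_add, pow_add]
    _ ≤ (q + 1) * (q - 1) * d := by
        gcongr
        · exact hle (by omega)
        · exact hle (by omega)
        · exact hle hd
    _ = (q ^ 2 - 1) * d := by rw [← Nat.sq_sub_sq, one_pow]
    _ ≤ d * q ^ 2 := by rw [mul_comm]; gcongr; exact Nat.sub_le _ _

theorem two_ne_zero_of_odd_card {F : Type*} [Field F] [Fintype F] (hq : Odd (Fintype.card F)) :
    (2 : F) ≠ 0 := by
  intro h
  obtain ⟨r, hr⟩ := hq
  have : ((Fintype.card F : ℕ) : F) = 0 := Nat.cast_card_eq_zero F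
  rw [hr] at this
  simp [h] at this

/-- A root `α` of `π` has 2-power order, and `α^(2^s) ≠ 1`, since otherwise the sum would equal `2^j
≠ 0`. So `2^s` divides the order of `α`, which divides `q^(deg π) - 1`. -/
theorem two_pow_le_natDegree_mul {F : Type*} [Field F] [Fintype F] (hq : Odd (Fintype.card F))
    {s j : ℕ} {π : F[X]} (hπ : Irreducible π)
    (hdvd : π ∣ ∑ i ∈ Finset.range (2 ^ j), (X ^ 2 ^ s : F[X]) ^ i) :
    2 ^ s ≤ π.natDegree * Fintype.card F ^ 2 := by
  classical
  have : Fact (Irreducible π) := ⟨hπ⟩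
  let pb := AdjoinRoot.powerBasis hπ.ne_zero
  have hfin : Module.Finite F (AdjoinRoot π) := pb.finite
  have hrank : Module.finrank F (AdjoinRoot π) = π.natDegree := by
    rw [pb.finrank, AdjoinRoot.powerBasis_dim]
  have : Finite (AdjoinRoot π) := Module.finite_of_finite F
  have := Fintype.ofFinite (AdjoinRoot π)
  have hcard : Fintype.card (AdjoinRoot π) = Fintype.card F ^ π.natDegree := by
    rw [Module.card_eq_pow_finrank (K := F), hrank]
  set α := AdjoinRoot.root π with hα
  have hsum : ∑ i ∈ Finset.range (2 ^ j), (α ^ 2 ^ s) ^ i = 0 := by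
    have := AdjoinRoot.mk_eq_zero.2 hdvd
    simpa only [map_sum, map_pow, AdjoinRoot.mk_X] using this
  have hne : α ^ 2 ^ s ≠ 1 := by
    intro h
    rw [h] at hsum
    have h2 : (2 : AdjoinRoot π) ≠ 0 := by
      have := (map_ne_zero (AdjoinRoot.of π)).2 (two_ne_zero_of_odd_card hq)
      rwa [map_ofNat] at this
    simp [h2] at hsum
  have hone : α ^ 2 ^ (s + j) = 1 := by
    have := geom_sum_mul (α ^ 2 ^ s) (2 ^ j)
    rw [hsum, zero_mul, ← pow_mul, ← pow_add] at this
    exact (sub_eq_zero.1 this.symm)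
  obtain ⟨e, -, he⟩ := (Nat.dvd_prime_pow Nat.prime_two).1 (orderOf_dvd_of_pow_eq_one hone)
  have hse : s ≤ e := by
    by_contra hlt
    exact hne (orderOf_dvd_iff_pow_eq_one.1 (he ▸ pow_dvd_pow 2 (by omega)))
  have hα0 : α ≠ 0 := by
    intro h
    rw [h, zero_pow (by positivity)] at hone
    exact zero_ne_one hone
  have hord := orderOf_dvd_of_pow_eq_one (FiniteField.pow_card_sub_one_eq_one α hα0)
  rw [he, hcard] at hord
  exact two_pow_le_of_dvd_pow_sub_one hq Fintype.one_lt_card hπ.natDegree_pos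
    ((pow_dvd_pow 2 hse).trans hord)

/-! ### Ideals of a quotient of `F[X]` -/

/-- If `G` has `r` irreducible factors, then the multiples of `A` generate at most `2 ^ r`
ideals modulo `A * G`. -/
theorem exists_finset_spans {F : Type*} [Field F] {P A G : F[X]} (hP : A * G = P) (hG : G ≠ 0)
    {r : ℕ} (hr : ∀ t : Multiset F[X], (∀ π ∈ t, Irreducible π ∧ π ∣ G) → t.prod ∣ G →
      Multiset.card t ≤ r) :
    ∃ 𝒥 : Finset (Ideal (AdjoinRoot P)), 𝒥.card ≤ 2 ^ r ∧
      ∀ p : F[X], Ideal.span {AdjoinRoot.mk P (A * p)} ∈ 𝒥 := by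
  classical
  let t := UniqueFactorizationMonoid.normalizedFactors G
  have ht : Associated t.prod G := UniqueFactorizationMonoid.prod_normalizedFactors hG
  let 𝒥 := (t.powerset.map fun u => Ideal.span {AdjoinRoot.mk P (A * u.prod)}).toFinset
  refine ⟨𝒥, ?_, ?_⟩
  · refine (Multiset.toFinset_card_le _).trans ?_
    rw [Multiset.card_map, Multiset.card_powerset]
    refine Nat.pow_le_pow_right two_pos (hr t (fun π hπ => ⟨?_, ?_⟩) ht.dvd)
    · exact UniqueFactorizationMonoid.irreducible_of_normalized_factor π hπ
    · exact UniqueFactorizationMonoid.dvd_of_mem_normalizedFactors hπ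
  · intro p
    -- Modulo `A G`, the element `A p` generates the same ideal as `A gcd(p, G)`, and the gcd is, up
    -- to a unit, a subproduct of the factors of `G`.
    let g := EuclideanDomain.gcd p G
    have hgG : g ∣ G := EuclideanDomain.gcd_dvd_right p G
    have hg0 : g ≠ 0 := fun h => hG (zero_dvd_iff.1 (h ▸ hgG))
    let u := UniqueFactorizationMonoid.normalizedFactors g
    have hu : Associated u.prod g := UniqueFactorizationMonoid.prod_normalizedFactors hg0
    have hut : u ≤ t :=
      (UniqueFactorizationMonoid.dvd_iff_normalizedFactors_le_normalizedFactors hg0 hG).1 hgG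
    rw [Multiset.mem_toFinset, Multiset.mem_map]
    refine ⟨u, Multiset.mem_powerset.2 hut, ?_⟩
    apply le_antisymm <;> rw [Ideal.span_singleton_le_span_singleton]
    · have hb : g = p * EuclideanDomain.gcdA p G + G * EuclideanDomain.gcdB p G :=
        EuclideanDomain.gcd_eq_gcd_ab p G
      obtain ⟨w', hw'⟩ := hu.dvd'
      refine ⟨AdjoinRoot.mk P (EuclideanDomain.gcdA p G * w'), ?_⟩
      rw [← map_mul, AdjoinRoot.mk_eq_mk]
      refine ⟨EuclideanDomain.gcdB p G * w', ?_⟩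
      rw [hw', hb, ← hP]
      ring
    · obtain ⟨w, hw⟩ := hu.dvd.trans (EuclideanDomain.gcd_dvd_left p G)
      refine ⟨AdjoinRoot.mk P w, ?_⟩
      rw [← map_mul]
      congr 1
      conv_lhs => rw [hw]
      ring

theorem finrank_degreeLT (F : Type*) [Field F] (n : ℕ) :
    Module.finrank F (degreeLT F n) = n := by
  rw [(degreeLTEquiv F n).finrank_eq, Module.finrank_fin_fun]

/-- If all irreducible factors of `G` have degree at least `n`, then a nonzero multiple of `A`
generates an ideal of dimension at least `n` modulo `A * G`. -/
theorem le_finrank_span {F : Type*} [Field F] {P A G : F[X]} (hP : A * G = P) (hP0 : P ≠ 0)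
    {n : ℕ} (hn : ∀ π : F[X], Irreducible π → π ∣ G → n ≤ π.natDegree) (p : F[X])
    (hp : AdjoinRoot.mk P (A * p) ≠ 0) :
    n ≤ Module.finrank F ((Ideal.span {AdjoinRoot.mk P (A * p)}).restrictScalars F) := by
  set f := AdjoinRoot.mk P (A * p) with hf
  have hfin : Module.Finite F (AdjoinRoot P) := (AdjoinRoot.powerBasis hP0).finite
  -- A nonzero `x` of degree below `n` is coprime to `G`. As `G f = 0`, a Bézout relation shows that
  -- `x f = 0` would force `f = 0`; hence `x ↦ x f` is injective.
  let L : degreeLT F n →ₗ[F] AdjoinRoot P :=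
    (LinearMap.mulRight F f).comp ((AdjoinRoot.mkₐ P).toLinearMap.comp (degreeLT F n).subtype)
  have hL : ∀ x, L x = AdjoinRoot.mk P x * f := fun x => rfl
  let L' : degreeLT F n →ₗ[F] (Ideal.span {f}).restrictScalars F :=
    L.codRestrict _ fun x =>
      show AdjoinRoot.mk P x * f ∈ Ideal.span {f} from
        Ideal.mul_mem_left _ _ (Ideal.mem_span_singleton_self f)
  rw [← finrank_degreeLT F n]
  apply LinearMap.finrank_le_finrank_of_injective (f := L')
  rw [← LinearMap.ker_eq_bot, LinearMap.ker_eq_bot']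
  rintro ⟨x, hx⟩ hx'
  have hx0 : L ⟨x, hx⟩ = 0 := congrArg Subtype.val hx'
  rw [hL] at hx0
  by_contra hne
  have hxne : x ≠ 0 := fun h => hne (Subtype.ext h)
  have hdeg : x.natDegree < n := (natDegree_lt_iff_degree_lt hxne).2 (mem_degreeLT.1 hx)
  obtain ⟨u, v, huv⟩ := isCoprime_of_irreducible_dvd (x := x) (y := G) (fun h => hxne h.1)
    fun π hπ hπx hπG => by
      have h1 := hn π hπ hπG
      have h2 := natDegree_le_of_dvd hπx hxne
      omega
  have hGf : AdjoinRoot.mk P G * f = 0 := by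
    rw [hf, ← map_mul, AdjoinRoot.mk_eq_zero]
    exact ⟨p, by rw [← hP]; ring⟩
  apply hp
  have h1 := congrArg (AdjoinRoot.mk P) huv
  rw [map_add, map_mul, map_mul, map_one] at h1
  dsimp only at hx0
  calc f = (AdjoinRoot.mk P u * AdjoinRoot.mk P x + AdjoinRoot.mk P v * AdjoinRoot.mk P G) * f := by
        rw [h1, one_mul]
    _ = AdjoinRoot.mk P u * (AdjoinRoot.mk P x * f)
        + AdjoinRoot.mk P v * (AdjoinRoot.mk P G * f) := by ring
    _ = 0 := by rw [hx0, hGf]; simp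

/-! ### Words and weights in `R_m` -/

theorem ofWord_apply {F : Type*} [Field F] {m : ℕ} (w : Fin m → F) :
    ofWord F m w = ∑ j, w j • AdjoinRoot.root (X ^ m - 1 : F[X]) ^ (j : ℕ) := rfl

theorem root_pow (F : Type*) [Field F] (m : ℕ) : AdjoinRoot.root (X ^ m - 1 : F[X]) ^ m = 1 := by
  have := AdjoinRoot.mk_self (f := (X ^ m - 1 : F[X]))
  rw [map_sub, map_pow, AdjoinRoot.mk_X, map_one] at this
  exact sub_eq_zero.1 this

section Weight

variable {F : Type*} [Field F] {m : ℕ} [NeZero m]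

/-- The identification of words of length `m` with elements of `R_m`. -/
noncomputable def wordEquiv (F : Type*) [Field F] (m : ℕ) [NeZero m] : (Fin m → F) ≃ₗ[F] R F m :=
  LinearEquiv.ofBijective (ofWord F m) (ofWord_bijective F (NeZero.pos m))

theorem wordEquiv_apply (w : Fin m → F) : wordEquiv F m w = ofWord F m w := rfl

/-- The Hamming weight of an element of `R_m`. -/
noncomputable def weight [DecidableEq F] (f : R F m) : ℕ := hammingNorm ((wordEquiv F m).symm f)

theorem root_pow_mul_ofWord_shift (w : Fin m → F) (t : Fin m) :
    AdjoinRoot.root (X ^ m - 1 : F[X]) ^ (t : ℕ) * ofWord F m (fun i => w (i + t))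
      = ofWord F m w := by
  rw [ofWord_apply, ofWord_apply, Finset.mul_sum,
    ← Equiv.sum_comp (Equiv.addRight t)
      fun j => w j • AdjoinRoot.root (X ^ m - 1 : F[X]) ^ (j : ℕ)]
  refine Finset.sum_congr rfl fun i _ => ?_
  change _ = w (i + t) • AdjoinRoot.root (X ^ m - 1 : F[X]) ^ ((i + t : Fin m) : ℕ)
  rw [mul_smul_comm, ← pow_add, Fin.val_add, ← pow_eq_pow_mod _ (root_pow F m),
    add_comm (t : ℕ)]

/-- Since `X^m = 1`, this cyclic shift is multiplication by `X^(m-t)`; ideals thus satisfy the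
translation invariance needed for the count of light pairs. -/
theorem ofWord_shift_mem (I : Ideal (R F m)) {w : Fin m → F} (hw : ofWord F m w ∈ I) (t : Fin m) :
    ofWord F m (fun i => w (i + t)) ∈ I := by
  have h := I.mul_mem_left (AdjoinRoot.root (X ^ m - 1 : F[X]) ^ (m - (t : ℕ))) hw
  rwa [← root_pow_mul_ofWord_shift w t, ← mul_assoc, ← pow_add,
    Nat.sub_add_cancel t.2.le, root_pow, one_mul] at h

/-- An ideal `I` of `R_m` of dimension `k` contains few pairs of small total weight. -/
theorem card_light_pairs_ideal_le [Fintype F] [DecidableEq F] (I : Ideal (R F m)) {τ : ℝ}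
    (h0 : 0 < τ) (h1 : τ ≤ 1 - (Fintype.card F : ℝ)⁻¹) (T : Finset (R F m × R F m))
    (hT : ∀ p ∈ T, p.1 ∈ I ∧ p.2 ∈ I ∧ (weight p.1 + weight p.2 : ℝ) ≤ 2 * m * τ) :
    (T.card : ℝ) ≤ m * (Fintype.card F : ℝ) ^
      (2 * Module.finrank F (I.restrictScalars F) * entropy (Fintype.card F) τ) := by
  classical
  let e := (wordEquiv F m).symm
  let J : Submodule F (Fin m → F) := (I.restrictScalars F).map (e : R F m →ₗ[F] (Fin m → F))
  have hmem : ∀ w, w ∈ J ↔ ofWord F m w ∈ I := by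
    intro w
    rw [Submodule.mem_map_equiv]
    rfl
  have hJ : ∀ u ∈ J, ∀ t, (fun i => u (i + t)) ∈ J := fun u hu t => by
    rw [hmem] at hu ⊢
    exact ofWord_shift_mem I hu t
  have hk : Module.finrank F J = Module.finrank F (I.restrictScalars F) :=
    LinearEquiv.finrank_map_eq e _
  have := card_light_pairs_le hJ h0 h1 (T.image (Prod.map e e)) (by
    intro p hp
    obtain ⟨p, hpT, rfl⟩ := Finset.mem_image.1 hp
    obtain ⟨hp1, hp2, hw⟩ := hT p hpT
    refine ⟨Submodule.mem_map_of_mem hp1, Submodule.mem_map_of_mem hp2, ?_⟩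
    simpa [weight] using hw)
  rwa [Finset.card_image_of_injective _ (Prod.map_injective.2 ⟨e.injective, e.injective⟩), hk,
    Fintype.card_fin] at this

end Weight

/-! ### Counting multipliers -/

/-- The solutions of `u * b = v` are at most as many as the annihilators of `u`. -/
theorem card_solutions_mul_card_span_le {A : Type*} [CommRing A] [Fintype A] [DecidableEq A]
    (u v : A) :
    (Finset.univ.filter fun b => u * b = v).card * Nat.card (Ideal.span {u}) ≤ Fintype.card A := by
  classical
  have hs : ∀ y : Ideal.span {u}, ∃ c, u * c = y := fun y => by
    obtain ⟨c, hc⟩ := Ideal.mem_span_singleton.1 y.2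
    exact ⟨c, hc.symm⟩
  choose σ hσ using hs
  -- With `u * σ y = y`, the map `(b, y) ↦ b + σ y` is injective: multiplying by `u` gives `v + y`,
  -- which recovers `y` and then `b`.
  rw [← Fintype.card_coe, ← Nat.card_eq_fintype_card, ← Nat.card_eq_fintype_card, ← Nat.card_prod]
  apply Nat.card_le_card_of_injective
    fun x : (Finset.univ.filter fun b => u * b = v) × Ideal.span {u} => (x.1 : A) + σ x.2
  rintro ⟨⟨b, hb⟩, y⟩ ⟨⟨b', hb'⟩, y'⟩ h
  have hb1 : u * b = v := (Finset.mem_filter.1 hb).2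
  have hb2 : u * b' = v := (Finset.mem_filter.1 hb').2
  dsimp only at h
  have h2 := congrArg (u * ·) h
  simp only [mul_add, hb1, hb2, hσ, add_right_inj] at h2
  obtain rfl : y = y' := Subtype.ext h2
  obtain rfl : b = b' := add_right_cancel h
  rfl

/-- If the elements of `U` generate few ideals, all of large dimension, then some `b` makes
`(f, f * b)` heavy for all `f` in `U`. -/
theorem exists_multiplier {F : Type*} [Field F] [Fintype F] [DecidableEq F] {m : ℕ} [NeZero m]
    {τ : ℝ} (h0 : 0 < τ) (h1 : τ ≤ 1 - (Fintype.card F : ℝ)⁻¹)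
    (hent : 2 * entropy (Fintype.card F) τ ≤ 1)
    (U : Set (R F m)) (𝒥 : Finset (Ideal (R F m))) (k₀ : ℝ)
    (hU : ∀ f ∈ U, Ideal.span {f} ∈ 𝒥 ∧
      k₀ ≤ Module.finrank F ((Ideal.span {f}).restrictScalars F))
    (hlt : 𝒥.card * (m * (Fintype.card F : ℝ) ^
      (-((1 - 2 * entropy (Fintype.card F) τ) * k₀))) < 1) :
    ∃ b : R F m, ∀ f ∈ U, 2 * m * τ < (weight f + weight (f * b) : ℝ) := by
  classical
  set q := Fintype.card F with hqdef
  set h := entropy q τ with hh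
  have hq1 : (1 : ℝ) < q := by exact_mod_cast Fintype.one_lt_card (α := F)
  have : Module.Finite F (R F m) := Module.Finite.equiv (wordEquiv F m)
  have : Finite (R F m) := Module.finite_of_finite F
  have := Fintype.ofFinite (R F m)
  by_contra hcon
  push Not at hcon
  choose φ hφU hφ using hcon
  have hcount : ∀ J ∈ 𝒥, ((Finset.univ.filter fun b => Ideal.span {φ b} = J).card : ℝ)
      ≤ Fintype.card (R F m) * (m * (q : ℝ) ^ (-((1 - 2 * h) * k₀))) := by
    intro J _
    set B := Finset.univ.filter fun b => Ideal.span {φ b} = J with hB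
    rcases B.eq_empty_or_nonempty with hemp | ⟨b₀, hb₀⟩
    · rw [hemp, Finset.card_empty, Nat.cast_zero]
      positivity
    have hspan : ∀ b ∈ B, Ideal.span {φ b} = J := fun b hb => (Finset.mem_filter.1 hb).2
    set k := Module.finrank F (J.restrictScalars F) with hk
    have hk₀ : k₀ ≤ k := by
      have := (hU _ (hφU b₀)).2
      rwa [hspan b₀ hb₀] at this
    have hcardJ : Nat.card J = q ^ k := by
      have : Finite (J.restrictScalars F) := inferInstanceAs (Finite J)
      have := Fintype.ofFinite (J.restrictScalars F)
      rw [hqdef, hk, ← Module.card_eq_pow_finrank, ← Nat.card_eq_fintype_card]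
      rfl
    let g : R F m → R F m × R F m := fun b => (φ b, φ b * b)
    -- All `b` with the same pair `(f, f b)` solve one linear equation whose coefficient `f`
    -- generates `J`.
    have hfib : ∀ p ∈ B.image g, (B.filter fun b => g b = p).card ≤ Fintype.card (R F m) / q ^ k := by
      intro p hp
      obtain ⟨b₁, hb₁, rfl⟩ := Finset.mem_image.1 hp
      rw [Nat.le_div_iff_mul_le (by positivity), ← hcardJ, ← hspan b₁ hb₁]
      refine le_trans (Nat.mul_le_mul_right _ (Finset.card_le_card ?_))
        (card_solutions_mul_card_span_le (φ b₁) (φ b₁ * b₁))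
      intro b hb
      have hg := (Finset.mem_filter.1 hb).2
      have e1 : φ b = φ b₁ := congrArg Prod.fst hg
      have e2 : φ b * b = φ b₁ * b₁ := congrArg Prod.snd hg
      rw [Finset.mem_filter]
      exact ⟨Finset.mem_univ _, by rw [← e2, e1]⟩
    have hBle := Finset.card_le_mul_card_image B _ hfib
    have hlight := card_light_pairs_ideal_le J h0 h1 (B.image g) (by
      intro p hp
      obtain ⟨b, hb, rfl⟩ := Finset.mem_image.1 hp
      have hmem : φ b ∈ J := hspan b hb ▸ Ideal.mem_span_singleton_self _
      exact ⟨hmem, J.mul_mem_right _ hmem, hφ b⟩)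
    calc (B.card : ℝ) ≤ ((Fintype.card (R F m) / q ^ k : ℕ) : ℝ) * (B.image g).card := by
          exact_mod_cast hBle
      _ ≤ (Fintype.card (R F m) / (q : ℝ) ^ k) * (m * (q : ℝ) ^ (2 * k * h)) := by
          gcongr
          exact_mod_cast Nat.cast_div_le (α := ℝ)
      _ = Fintype.card (R F m) * (m * (q : ℝ) ^ (-((1 - 2 * h) * k))) := by
          rw [← Real.rpow_natCast, div_eq_mul_inv, ← Real.rpow_neg (by positivity)]
          rw [show -((1 - 2 * h) * k) = -(k : ℝ) + 2 * k * h by ring,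
            Real.rpow_add (by positivity)]
          ring
      _ ≤ _ := by
          gcongr
          · exact hq1.le
  have htotal : Fintype.card (R F m)
      = ∑ J ∈ 𝒥, (Finset.univ.filter fun b => Ideal.span {φ b} = J).card := by
    rw [← Finset.card_univ]
    exact Finset.card_eq_sum_card_fiberwise fun b _ => (hU _ (hφU b)).1
  have hpos : (0 : ℝ) < Fintype.card (R F m) := by exact_mod_cast Fintype.card_pos
  have : (Fintype.card (R F m) : ℝ)
      ≤ 𝒥.card * (Fintype.card (R F m) * (m * (q : ℝ) ^ (-((1 - 2 * h) * k₀)))) := by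
    calc (Fintype.card (R F m) : ℝ)
        = ∑ J ∈ 𝒥, ((Finset.univ.filter fun b => Ideal.span {φ b} = J).card : ℝ) := by
          exact_mod_cast htotal
      _ ≤ ∑ _J ∈ 𝒥, Fintype.card (R F m) * (m * (q : ℝ) ^ (-((1 - 2 * h) * k₀))) :=
          Finset.sum_le_sum hcount
      _ = _ := by rw [Finset.sum_const, nsmul_eq_mul]
  nlinarith

/-! ### The codes -/

section Code

variable {F : Type*} [Field F] {m : ℕ}

/-- The quasi-cyclic code generated by `((X ^ m + 1) A, A B)`. -/
noncomputable def generatorMap (m : ℕ) (A B : F[X]) : F[X] →ₗ[F] R F (2 * m) × R F m :=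
  LinearMap.prod
    ((AdjoinRoot.mkₐ _).toLinearMap ∘ₗ LinearMap.mulRight F ((X ^ m + 1) * A))
    ((AdjoinRoot.mkₐ _).toLinearMap ∘ₗ LinearMap.mulRight F (A * B))

theorem generatorMap_apply (A B p : F[X]) :
    generatorMap m A B p
      = (AdjoinRoot.mk _ (p * ((X ^ m + 1) * A)), AdjoinRoot.mk _ (p * (A * B))) := rfl

theorem isQuasiCyclic_range (A B : F[X]) : IsQuasiCyclic (generatorMap m A B).range := by
  rintro _ ⟨p, rfl⟩
  refine ⟨X * p, ?_⟩
  simp only [generatorMap_apply, map_mul, AdjoinRoot.mk_X, mul_assoc]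

theorem X_pow_two_mul_sub_one (F : Type*) [Field F] (m : ℕ) :
    (X ^ (2 * m) - 1 : F[X]) = (X ^ m + 1) * (X ^ m - 1) := by
  rw [two_mul, pow_add]
  ring

theorem monic_X_pow_sub_one (F : Type*) [Field F] {n : ℕ} (hn : n ≠ 0) :
    (X ^ n - 1 : F[X]).Monic := monic_X_pow_sub_C (1 : F) hn

theorem natDegree_X_pow_sub_one (F : Type*) [Field F] (n : ℕ) :
    (X ^ n - 1 : F[X]).natDegree = n := natDegree_X_pow_sub_C (r := (1 : F))

theorem ofWords_bijective (F : Type*) [Field F] (hm : 0 < m) :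
    Function.Bijective (ofWords F m) := by
  have h1 := ofWord_bijective F (n := 2 * m) (by omega)
  have h2 := ofWord_bijective F hm
  constructor
  · intro w w' h
    have e1 := h1.1 (congrArg Prod.fst h)
    have e2 := h2.1 (congrArg Prod.snd h)
    funext i
    induction i using Fin.addCases with
    | left i => exact congrFun e1 i
    | right i => exact congrFun e2 i
  · rintro ⟨a, b⟩
    obtain ⟨u, rfl⟩ := h1.2 a
    obtain ⟨v, rfl⟩ := h2.2 b
    refine ⟨Fin.append u v, Prod.ext ?_ ?_⟩
    · exact congrArg (ofWord F (2 * m)) (funext fun i => Fin.append_left u v i)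
    · exact congrArg (ofWord F m) (funext fun i => Fin.append_right u v i)

theorem finrank_toCode (hm : 0 < m) (C : Submodule F (R F (2 * m) × R F m)) :
    Module.finrank F (toCode C) = Module.finrank F C := by
  let e := LinearEquiv.ofBijective (ofWords F m) (ofWords_bijective F hm)
  have : toCode C = C.map (e.symm : _ →ₗ[F] _) := by
    ext w
    rw [Submodule.mem_map_equiv]
    rfl
  rw [this, LinearEquiv.finrank_map_eq]

/-- The first component alone vanishes exactly when `G ∣ p`, and then the second vanishes too; so
the range is a copy of `F[X]/(G)`. -/
theorem finrank_range_generatorMap (hm : 0 < m) {A G : F[X]} (hAG : A * G = X ^ m - 1)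
    (B : F[X]) : Module.finrank F (generatorMap m A B).range = G.natDegree := by
  have hP := monic_X_pow_sub_one F hm.ne'
  have hA0 : A ≠ 0 := fun h => hP.ne_zero (by rw [← hAG, h, zero_mul])
  have hG0 : G ≠ 0 := fun h => hP.ne_zero (by rw [← hAG, h, mul_zero])
  have hX0 : (X ^ m + 1 : F[X]) ≠ 0 := (monic_X_pow_add_C (1 : F) hm.ne').ne_zero
  have hker : ∀ p, generatorMap m A B p = 0 ↔ G ∣ p := by
    intro p
    rw [generatorMap_apply, Prod.mk_eq_zero, AdjoinRoot.mk_eq_zero, AdjoinRoot.mk_eq_zero,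
      X_pow_two_mul_sub_one, ← hAG, mul_left_comm p, mul_dvd_mul_iff_left hX0, mul_comm p A,
      mul_dvd_mul_iff_left hA0]
    refine ⟨fun h => h.1, fun h => ⟨h, ?_⟩⟩
    rw [mul_left_comm]
    exact mul_dvd_mul_left A (h.mul_right B)
  let L := (generatorMap m A B).domRestrict (degreeLT F G.natDegree)
  have hL : Function.Injective L := by
    rw [← LinearMap.ker_eq_bot, LinearMap.ker_eq_bot']
    rintro ⟨p, hp⟩ h
    refine Subtype.ext (eq_zero_of_dvd_of_degree_lt ((hker p).1 h) ?_)
    rw [degree_eq_natDegree hG0]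
    exact mem_degreeLT.1 hp
  have hrange : L.range = (generatorMap m A B).range := by
    apply le_antisymm
    · rintro _ ⟨p, rfl⟩
      exact ⟨p, rfl⟩
    · rintro _ ⟨p, rfl⟩
      refine ⟨⟨p % G, mem_degreeLT.2 ?_⟩, ?_⟩
      · rw [← degree_eq_natDegree hG0]
        exact EuclideanDomain.mod_lt p hG0
      · change generatorMap m A B (p % G) = generatorMap m A B p
        rw [← sub_eq_zero, ← map_sub, hker]
        exact ⟨-(p / G), by linear_combination EuclideanDomain.div_add_mod p G⟩
  rw [← hrange, LinearMap.finrank_range_of_inj hL, finrank_degreeLT]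

/-- By `X^(2m) - 1 = (X^m + 1)(X^m - 1)`, the product `(X^m + 1) p` modulo `X^(2m) - 1` depends only
on `p` modulo `X^m - 1`. -/
theorem ofWord_repeat [NeZero m] (u : Fin m → F) (p : F[X])
    (hu : ofWord F m u = AdjoinRoot.mk _ p) :
    ofWord F (2 * m) (fun j => u (Fin.ofNat m (j : ℕ))) = AdjoinRoot.mk _ ((X ^ m + 1) * p) := by
  have hmk : ∀ (n : ℕ) (w : Fin n → F),
      ofWord F n w = AdjoinRoot.mk _ (∑ j, C (w j) * X ^ (j : ℕ)) := by
    intro n w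
    simp only [ofWord_apply, map_sum, map_mul, map_pow, AdjoinRoot.mk_X, AdjoinRoot.mk_C,
      Algebra.smul_def, AdjoinRoot.algebraMap_eq]
  rw [hmk, AdjoinRoot.mk_eq_mk] at hu
  rw [hmk, AdjoinRoot.mk_eq_mk, X_pow_two_mul_sub_one]
  have hsum : ∑ j : Fin (2 * m), C (u (Fin.ofNat m (j : ℕ))) * X ^ (j : ℕ)
      = (X ^ m + 1) * ∑ j : Fin m, C (u j) * X ^ (j : ℕ) := by
    have h1 : ∑ j : Fin m, C (u j) * X ^ (j : ℕ)
        = ∑ j ∈ Finset.range m, C (u (Fin.ofNat m j)) * X ^ j := by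
      rw [← Fin.sum_univ_eq_sum_range fun j => C (u (Fin.ofNat m j)) * X ^ j]
      simp
    rw [Fin.sum_univ_eq_sum_range fun j => C (u (Fin.ofNat m j)) * X ^ j, h1, two_mul,
      Finset.sum_range_add, add_mul, one_mul, add_comm, Finset.mul_sum]
    congr 1
    refine Finset.sum_congr rfl fun j _ => ?_
    have : Fin.ofNat m (m + j) = Fin.ofNat m j := Fin.ext (by simp)
    rw [this, pow_add]
    ring
  rw [hsum, ← mul_sub]
  exact mul_dvd_mul_left _ hu

/-- The nonzero codewords are at least as heavy as the pairs `(A p, A p B)`. -/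
theorem exists_weight_le [DecidableEq F] [NeZero m] {A B : F[X]} {c : Fin (2 * m + m) → F}
    (hc : c ∈ toCode (generatorMap m A B).range) (hc0 : c ≠ 0) :
    ∃ p : F[X], AdjoinRoot.mk (X ^ m - 1) (A * p) ≠ 0 ∧
      weight (AdjoinRoot.mk (X ^ m - 1) (A * p))
        + weight (AdjoinRoot.mk (X ^ m - 1) (A * p) * AdjoinRoot.mk (X ^ m - 1) B)
        ≤ hammingNorm c := by
  obtain ⟨p, hp⟩ := hc
  rw [generatorMap_apply] at hp
  have hp1 := congrArg Prod.fst hp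
  have hp2 := congrArg Prod.snd hp
  dsimp only at hp1 hp2
  set c₁ : Fin (2 * m) → F := fun i => c (Fin.castAdd m i) with hc₁
  set c₂ : Fin m → F := fun i => c (Fin.natAdd (2 * m) i) with hc₂
  change _ = ofWord F (2 * m) c₁ at hp1
  change _ = ofWord F m c₂ at hp2
  set f := AdjoinRoot.mk (X ^ m - 1) (A * p) with hf
  set u := (wordEquiv F m).symm f with hu
  have hfu : ofWord F m u = f := (wordEquiv F m).apply_symm_apply f
  have h1 : c₁ = fun j : Fin (2 * m) => u (Fin.ofNat m (j : ℕ)) := by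
    apply (ofWord_bijective F (n := 2 * m) (by have := NeZero.pos m; omega)).1
    rw [ofWord_repeat u (A * p) hfu, ← hp1]
    congr 1
    ring
  have h2 : (wordEquiv F m).symm (f * AdjoinRoot.mk (X ^ m - 1) B) = c₂ := by
    rw [LinearEquiv.symm_apply_eq, wordEquiv_apply, ← hp2, hf, ← map_mul]
    congr 1
    ring
  have hnorm : hammingNorm c = hammingNorm c₁ + hammingNorm c₂ := by
    simp only [hammingNorm, Finset.card_filter, Fin.sum_univ_add, hc₁, hc₂]
  refine ⟨p, ?_, ?_⟩
  · intro hf0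
    change f = 0 at hf0
    apply hc0
    have hu0 : u = 0 := by rw [hu, hf0, map_zero]
    have h2' : c₂ = 0 := by rw [← h2, hf0, zero_mul, map_zero]
    funext i
    induction i using Fin.addCases with
    | left i =>
      have := congrFun h1 i
      rwa [hu0] at this
    | right i => exact congrFun h2' i
  · rw [hnorm]
    refine Nat.add_le_add ?_ (le_of_eq (by rw [weight, h2]))
    rw [weight, ← hu, h1]
    -- Only the first of the two copies of `u` is counted.
    refine Finset.card_le_card_of_injOn (Fin.castLE (by omega)) ?_
      (Fin.castLE_injective (by omega)).injOn
    intro i hi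
    simpa using hi

end Code

/-! ### Choice of parameters -/

/-- Quasi-cyclic codes of index `1½` beyond the relative distance `2τ/3`, of any rate
`(1 - 2⁻ʲ)/3` and arbitrarily large co-index. -/
theorem exists_heavy_code {F : Type*} [Field F] [Fintype F] [DecidableEq F]
    (hq : Odd (Fintype.card F)) {τ : ℝ} (h0 : 0 < τ) (h1 : τ ≤ 1 - (Fintype.card F : ℝ)⁻¹)
    (hent : 2 * entropy (Fintype.card F) τ < 1) (j N : ℕ) :
    ∃ m : ℕ, N ≤ m ∧ 0 < m ∧ m.Coprime (Fintype.card F) ∧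
      ∃ C : Submodule F (R F (2 * m) × R F m), IsQuasiCyclic C ∧
        rate (toCode C) = (1 - (1 / 2) ^ j) / 3 ∧
        ∀ c ∈ toCode C, c ≠ 0 → 2 * m * τ < hammingNorm c := by
  set q := Fintype.card F with hqdef
  set h := entropy q τ with hh
  have hq1 : (1 : ℝ) < q := by exact_mod_cast Fintype.one_lt_card (α := F)
  -- Factors of degree at least `2^s/q²` in a polynomial of degree at most `2^s 2^j` number at most
  -- `q² 2^j`.
  set r := q ^ 2 * 2 ^ j with hr
  set ρ : ℝ := (q : ℝ) ^ (-((1 - 2 * h) / (q : ℝ) ^ 2)) with hρ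
  have hρ1 : ρ < 1 := Real.rpow_lt_one_of_one_lt_of_neg hq1 <| by
    rw [neg_lt_zero]
    have : 0 < 1 - 2 * h := by linarith
    positivity
  have hlim : Tendsto (fun s : ℕ => (2 : ℝ) ^ r * (2 ^ j * (((2 ^ s : ℕ) : ℝ) * ρ ^ 2 ^ s)))
      atTop (𝓝 0) := by
    have h1 := (tendsto_self_mul_const_pow_of_lt_one (by positivity) hρ1).comp
      (tendsto_pow_atTop_atTop_of_one_lt one_lt_two)
    simpa using (h1.const_mul ((2 : ℝ) ^ j)).const_mul ((2 : ℝ) ^ r)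
  obtain ⟨s, hs, hNs⟩ := ((hlim.eventually_lt_const one_pos).and
    ((tendsto_pow_atTop_atTop_of_one_lt one_lt_two).eventually_ge_atTop N)).exists
  set m := 2 ^ s * 2 ^ j with hm
  have hmpos : 0 < m := by positivity
  have : NeZero m := ⟨hmpos.ne'⟩
  set A : F[X] := X ^ 2 ^ s - 1 with hA
  set G : F[X] := ∑ i ∈ Finset.range (2 ^ j), (X ^ 2 ^ s) ^ i with hG
  have hAG : A * G = X ^ m - 1 := by
    rw [mul_comm, hG, hA, geom_sum_mul, ← pow_mul]
  have hP := monic_X_pow_sub_one F hmpos.ne'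
  have hA0 : A ≠ 0 := fun h => hP.ne_zero (by rw [← hAG, h, zero_mul])
  have hG0 : G ≠ 0 := fun h => hP.ne_zero (by rw [← hAG, h, mul_zero])
  have hdeg : 2 ^ s + G.natDegree = m := by
    have := natDegree_X_pow_sub_one F m
    rwa [← hAG, natDegree_mul hA0 hG0, natDegree_X_pow_sub_one] at this
  have hirr : ∀ π : F[X], Irreducible π → π ∣ G → 2 ^ s ≤ π.natDegree * q ^ 2 :=
    fun π hπ hπG => two_pow_le_natDegree_mul hq hπ hπG
  obtain ⟨𝒥, h𝒥card, h𝒥⟩ := exists_finset_spans hAG hG0 (r := r) (by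
    intro t ht htG
    have h1 : Multiset.card t * 2 ^ s ≤ (t.map fun π => π.natDegree * q ^ 2).sum := by
      have := Multiset.card_nsmul_le_sum (s := t.map fun π => π.natDegree * q ^ 2) (a := 2 ^ s)
        (by
          intro x hx
          obtain ⟨π, hπ, rfl⟩ := Multiset.mem_map.1 hx
          exact hirr π (ht π hπ).1 (ht π hπ).2)
      simpa using this
    rw [Multiset.sum_map_mul_right,
      ← natDegree_multiset_prod t fun h => (ht 0 h).1.ne_zero rfl] at h1
    have h2 := natDegree_le_of_dvd htG hG0
    refine Nat.le_of_mul_le_mul_right (h1.trans ?_) (Nat.two_pow_pos s)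
    calc t.prod.natDegree * q ^ 2 ≤ m * q ^ 2 := Nat.mul_le_mul_right _ (by omega)
      _ = r * 2 ^ s := by rw [hm, hr]; ring)
  obtain ⟨b, hb⟩ := exists_multiplier (F := F) h0 h1 hent.le
    {f | f ≠ 0 ∧ ∃ p, f = AdjoinRoot.mk (X ^ m - 1) (A * p)} 𝒥 (((2 ^ s : ℕ) : ℝ) / q ^ 2) (by
      rintro f ⟨hf0, p, rfl⟩
      refine ⟨h𝒥 p, ?_⟩
      set n := Module.finrank F
        ((Ideal.span {AdjoinRoot.mk (X ^ m - 1) (A * p)}).restrictScalars F) with hn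
      rw [div_le_iff₀ (by positivity)]
      by_contra hlt
      have hlt' : n * q ^ 2 < 2 ^ s := by
        push Not at hlt
        exact_mod_cast hlt
      -- If the dimension `n` were below `2^s/q²`, every irreducible factor would have degree at
      -- least `n + 1`, forcing dimension at least `n + 1`.
      have := le_finrank_span hAG hP.ne_zero (n := n + 1)
        (fun π hπ hπG => Nat.succ_le_of_lt
          (Nat.lt_of_mul_lt_mul_right (hlt'.trans_le (hirr π hπ hπG)))) p hf0
      omega) (by
      refine lt_of_le_of_lt ?_ hs
      have e : (q : ℝ) ^ (-((1 - 2 * h) * (((2 ^ s : ℕ) : ℝ) / q ^ 2))) = ρ ^ 2 ^ s := by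
        rw [hρ, ← Real.rpow_mul_natCast (by positivity)]
        congr 1
        ring
      rw [e]
      calc (𝒥.card : ℝ) * (m * ρ ^ 2 ^ s) ≤ 2 ^ r * (m * ρ ^ 2 ^ s) := by
            gcongr
            exact_mod_cast h𝒥card
        _ = _ := by rw [hm]; push_cast; ring)
  obtain ⟨B, rfl⟩ := AdjoinRoot.mk_surjective b
  refine ⟨m, hNs.trans (Nat.le_mul_of_pos_right _ (by positivity)), hmpos, ?_,
    (generatorMap m A B).range, isQuasiCyclic_range A B, ?_, ?_⟩
  · rw [hm, ← pow_add]
    exact (Nat.coprime_two_left.2 hq).pow_left _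
  · rw [rate, finrank_toCode hmpos, finrank_range_generatorMap hmpos hAG]
    have hd : (G.natDegree : ℝ) = 2 ^ s * 2 ^ j - 2 ^ s := by
      rw [eq_sub_iff_add_eq, add_comm]
      exact_mod_cast hdeg
    rw [hd, hm]
    push_cast
    rw [one_div, inv_pow]
    field_simp
    ring
  · intro c hc hc0
    obtain ⟨p, hp0, hp⟩ := exists_weight_le hc hc0
    exact (hb _ ⟨hp0, p, rfl⟩).trans_le (by exact_mod_cast hp)

/-! ### The entropy threshold and the sequence of codes -/

theorem entropyInv_half {q : ℕ} (hq : 2 ≤ q) :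
    entropyInv q (1 / 2) ∈ Set.Icc 0 (1 - (q : ℝ)⁻¹) ∧ entropy q (entropyInv q (1 / 2)) = 1 / 2 := by
  have h := (entropy_bijOn hq).surjOn (show (1 / 2 : ℝ) ∈ Set.Icc 0 1 by norm_num)
  exact ⟨Function.invFunOn_mem h, Function.invFunOn_eq h⟩

theorem entropyInv_half_pos {q : ℕ} (hq : 2 ≤ q) : 0 < entropyInv q (1 / 2) := by
  obtain ⟨h1, h2⟩ := entropyInv_half hq
  refine lt_of_le_of_ne h1.1 fun h => ?_
  rw [← h] at h2
  norm_num [entropy] at h2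

theorem entropy_lt_half {q : ℕ} (hq : 2 ≤ q) {τ : ℝ} (h0 : 0 < τ)
    (h1 : τ < entropyInv q (1 / 2)) : entropy q τ < 1 / 2 := by
  obtain ⟨h2, h3⟩ := entropyInv_half hq
  have hlog : 0 < Real.log q := Real.log_pos (by exact_mod_cast hq)
  rw [← h3, entropy_eq, entropy_eq]
  rw [← one_div] at h2
  exact div_lt_div_of_pos_right
    (Real.qaryEntropy_strictMonoOn hq ⟨h0.le, (h1.trans_le h2.2).le⟩ h2 h1) hlog

/-- The first half of the main theorem: sequences of codes of rates `(1 - 2⁻⁽ⁱ⁺¹⁾)/3`. -/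
theorem exists_code_sequence {F : Type*} [Field F] [Fintype F] [DecidableEq F]
    (hq : Odd (Fintype.card F)) {δ : ℝ} (h0 : 0 < δ)
    (h1 : δ < 2 / 3 * entropyInv (Fintype.card F) (1 / 2)) :
    ∃ (m : ℕ → ℕ) (C : ∀ i, Submodule F (R F (2 * m i) × R F (m i))),
      (∀ i, i ≤ m i ∧ 0 < m i ∧ (m i).Coprime (Fintype.card F) ∧ IsQuasiCyclic (C i)) ∧
      (∀ i, rate (toCode (C i)) = (1 - (1 / 2) ^ (i + 1)) / 3) ∧
      ∀ i, δ < relMinDist (toCode (C i)) := by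
  have hq2 : 2 ≤ Fintype.card F := Fintype.one_lt_card
  have hτ : 3 / 2 * δ < entropyInv (Fintype.card F) (1 / 2) := by linarith
  have hτ1 := hτ.le.trans (entropyInv_half hq2).1.2
  have hent := entropy_lt_half hq2 (by linarith) hτ
  -- With `τ = 3δ/2` the weight bound `2mτ` is `δ` times the length `3m`. The exponent `i + 1` keeps
  -- the rate positive, and `m ≥ i` makes the lengths unbounded.
  have key := fun i : ℕ =>
    exists_heavy_code hq (τ := 3 / 2 * δ) (by linarith) hτ1 (by linarith) (i + 1) i
  choose m hmi hm0 hmq C hC hrate hwt using key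
  refine ⟨m, C, fun i => ⟨hmi i, hm0 i, hmq i, hC i⟩, hrate, fun i => ?_⟩
  have hmR : (0 : ℝ) < m i := by exact_mod_cast hm0 i
  -- The zero code has `minDist` equal to `0` by the convention for `sInf ∅`, so it must be excluded
  -- before the infimum is attained.
  have hne : toCode (C i) ≠ ⊥ := by
    intro hbot
    have h := hrate i
    have hlt : (1 / 2 : ℝ) ^ (i + 1) < 1 := pow_lt_one₀ (by norm_num) (by norm_num) (by omega)
    rw [rate, hbot, finrank_bot, Nat.cast_zero, zero_div] at h
    linarith
  obtain ⟨c, hc, hc0⟩ := Submodule.exists_mem_ne_zero_of_ne_bot hne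
  obtain ⟨c', hc', hc0', hd⟩ := Nat.sInf_mem
    (s := {w : ℕ | ∃ c ∈ toCode (C i), c ≠ 0 ∧ hammingNorm c = w}) ⟨_, c, hc, hc0, rfl⟩
  have hw := hwt i c' hc' hc0'
  rw [hd] at hw
  rw [relMinDist, lt_div_iff₀ (by push_cast; linarith)]
  refine lt_of_le_of_lt (le_of_eq ?_) hw
  push_cast
  ring

end QuasiCyclic

open QuasiCyclic in
theorem theorem3p3 {F : Type*} [Field F] [Fintype F] [DecidableEq F]
    (hq : Odd (Fintype.card F)) :
    (∀ δ : ℝ, 0 < δ → δ < 2 / 3 * entropyInv (Fintype.card F) (1 / 2) →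
      ∃ (m : ℕ → ℕ) (C : ∀ i, Submodule F (R F (2 * m i) × R F (m i))),
        (∀ i, 0 < m i ∧ (m i).Coprime (Fintype.card F) ∧ IsQuasiCyclic (C i)) ∧
        Tendsto (fun i => 2 * m i) atTop atTop ∧
        Tendsto (fun i => rate (toCode (C i))) atTop (𝓝 (1 / 3)) ∧
        ∀ i, δ < relMinDist (toCode (C i))) ∧
    IsAsymptoticallyGoodClass (quasiCyclicCodes F) := by
  constructor
  · intro δ h0 h1
    obtain ⟨m, C, hC, hrate, hdist⟩ := exists_code_sequence hq h0 h1
    refine ⟨m, C, fun i => (hC i).2, ?_, ?_, hdist⟩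
    · exact tendsto_atTop_mono (fun i => by have := (hC i).1; dsimp only [id]; omega) tendsto_id
    · simp_rw [hrate]
      have h : Tendsto (fun i : ℕ => (1 / 2 : ℝ) ^ (i + 1)) atTop (𝓝 0) :=
        (tendsto_pow_atTop_nhds_zero_of_lt_one (by norm_num) (by norm_num)).comp
          (tendsto_add_atTop_nat 1)
      simpa using (h.const_sub 1).div_const 3
  · have hpos := entropyInv_half_pos (q := Fintype.card F) Fintype.one_lt_card
    set δ := 1 / 3 * entropyInv (Fintype.card F) (1 / 2) with hδ
    have h0 : 0 < δ := by positivity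
    obtain ⟨m, C, hC, hrate, hdist⟩ := exists_code_sequence hq h0 (by linarith)
    refine ⟨fun i => 2 * m i + m i, fun i => toCode (C i),
      fun i => ⟨m i, (hC i).2.1, (hC i).2.2.1, C i, (hC i).2.2.2, rfl⟩,
      tendsto_atTop_mono (fun i => by have := (hC i).1; dsimp only [id]; omega) tendsto_id,
      ⟨1 / 6, by norm_num, fun i => ?_⟩, δ, h0, fun i => (hdist i).le⟩
    have h : (1 / 2 : ℝ) ^ (i + 1) ≤ 1 / 2 :=
      pow_le_of_le_one (by norm_num) (by norm_num) (by omega)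
    rw [hrate]
    linarith
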